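/- Let $G$ be a profinite group. An almost finite $G$-space is a discrete topological space $X$ with a continuous action of $G$ such that for every open subgroup $U$ of $G$ the set $X^U$ of $U$-fixed points is finite. The isomorphism classes of almost finite $G$-spaces form a commutative semiring under disjoint union and cartesian product; the Burnside ring $\widehat B(G)$ is its Grothendieck ring. For an open normal subgroup $N$ of $G$ let $\operatorname{Fix}_N:\widehat B(G)\to\widehat B(G/N)=B(G/N)$ be the ring homomorphism $[X]\mapsto[X^N]$, and give $\widehat B(G)$ the topology in which the ideals $\ker(\operatorname{Fix}_N)$, $N\trianglelefteq_o G$, form a basis of neighbourhoods of $0$. The group $G$ is prosoluble if $G/N$ is soluble for every open normal subgroup $N$ of $G$. Then $G$ is prosoluble if and only if the only idempotents of $\widehat B(G)$ are $0$ and $1$. Moreover, $G$ is prosoluble if and only if the space of closed prime ideals of $\widehat B(G)$, with the Zariski topology, is connected, and if and only if the space $\operatorname{Spec}\widehat B(G)$ of all prime ideals of $\widehat B(G)$, with the Zariski topology, is connected. -/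

import Mathlib

universe u v

/-! ### The Grothendieck ring of a commutative semiring -/

/-- The Grothendieck ring of a commutative semiring `S`: the Grothendieck group of the additive
monoid of `S`, with the multiplication extended biadditively from `S`. -/
def GrothendieckRing (S : Type u) [CommSemiring S] : Type u :=
  Algebra.GrothendieckAddGroup S

namespace GrothendieckRing

noncomputable section

variable {S : Type u} {T : Type v} [CommSemiring S] [CommSemiring T]

instance : AddCommGroup (GrothendieckRing S) :=
  inferInstanceAs (AddCommGroup (Algebra.GrothendieckAddGroup S))

/-- The class of an element of `S` in its Grothendieck ring. -/
def ofAdd : S →+ GrothendieckRing S := Algebra.GrothendieckAddGroup.of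

/-- Extension of an additive map on `S` to the Grothendieck ring. -/
def liftAdd {A : Type v} [AddCommGroup A] (f : S →+ A) : GrothendieckRing S →+ A :=
  Algebra.GrothendieckAddGroup.lift f

@[simp] theorem liftAdd_ofAdd {A : Type v} [AddCommGroup A] (f : S →+ A) (s : S) :
    liftAdd f (ofAdd s) = f s :=
  DFunLike.congr_fun (Algebra.GrothendieckAddGroup.lift.symm_apply_apply f) s

/-- Every element of the Grothendieck ring is a difference of two classes. -/
theorem exists_sub (x : GrothendieckRing S) : ∃ a b : S, x = ofAdd a - ofAdd b := by
  induction x using AddLocalization.ind with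
  | H y =>
    obtain ⟨a, b⟩ := y
    refine ⟨a, b, ?_⟩
    have h := AddLocalization.mk_eq_addMonoidOf_mk'_apply (S := (⊤ : AddSubmonoid S)) a b
    refine eq_sub_of_add_eq ?_
    rw [h]
    exact (AddLocalization.addMonoidOf (⊤ : AddSubmonoid S)).mk'_spec a b

/-- The biadditive extension of the multiplication of `S`. -/
def mulHom : GrothendieckRing S →+ GrothendieckRing S →+ GrothendieckRing S :=
  liftAdd
    { toFun := fun s => liftAdd (ofAdd.comp (AddMonoidHom.mulLeft s))
      map_zero' := by
        ext x
        obtain ⟨a, b, rfl⟩ := exists_sub x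
        simp
      map_add' := fun s t => by
        ext x
        obtain ⟨a, b, rfl⟩ := exists_sub x
        simp [add_mul]
        abel }

instance : Mul (GrothendieckRing S) := ⟨fun x y => mulHom x y⟩

instance : One (GrothendieckRing S) := ⟨ofAdd 1⟩

theorem mul_def (x y : GrothendieckRing S) : x * y = mulHom x y := rfl

theorem one_def : (1 : GrothendieckRing S) = ofAdd 1 := rfl

theorem ofAdd_mul (a b : S) : ofAdd (a * b) = ofAdd a * ofAdd b := by
  simp [mul_def, mulHom]

instance : CommRing (GrothendieckRing S) where
  __ := (inferInstance : AddCommGroup (GrothendieckRing S))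
  left_distrib x y z := by simp [mul_def]
  right_distrib x y z := by simp [mul_def]
  zero_mul x := by simp [mul_def]
  mul_zero x := by simp [mul_def]
  mul_assoc x y z := by
    obtain ⟨a, b, rfl⟩ := exists_sub x
    obtain ⟨c, d, rfl⟩ := exists_sub y
    obtain ⟨e, f, rfl⟩ := exists_sub z
    simp only [mul_def, map_sub, AddMonoidHom.sub_apply]
    simp only [← mul_def, ← ofAdd_mul, mul_assoc]
  one_mul x := by
    obtain ⟨a, b, rfl⟩ := exists_sub x
    simp only [one_def, mul_def, map_sub]
    simp only [← mul_def, ← ofAdd_mul, one_mul]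
  mul_one x := by
    obtain ⟨a, b, rfl⟩ := exists_sub x
    simp only [one_def, mul_def, map_sub, AddMonoidHom.sub_apply]
    simp only [← mul_def, ← ofAdd_mul, mul_one]
  mul_comm x y := by
    obtain ⟨a, b, rfl⟩ := exists_sub x
    obtain ⟨c, d, rfl⟩ := exists_sub y
    simp only [mul_def, map_sub, AddMonoidHom.sub_apply]
    simp only [← mul_def, ← ofAdd_mul, mul_comm c, mul_comm d]
    abel

/-- The ring homomorphism between Grothendieck rings induced by a homomorphism of semirings. -/
def map (f : S →+* T) : GrothendieckRing S →+* GrothendieckRing T where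
  __ := liftAdd (ofAdd.comp f.toAddMonoidHom)
  map_one' := by
    change liftAdd (ofAdd.comp f.toAddMonoidHom) (ofAdd 1) = ofAdd 1
    simp
  map_mul' x y := by
    change liftAdd (ofAdd.comp f.toAddMonoidHom) (x * y)
      = liftAdd (ofAdd.comp f.toAddMonoidHom) x * liftAdd (ofAdd.comp f.toAddMonoidHom) y
    obtain ⟨a, b, rfl⟩ := exists_sub x
    obtain ⟨c, d, rfl⟩ := exists_sub y
    simp only [sub_mul, mul_sub, ← ofAdd_mul, map_sub, liftAdd_ofAdd, AddMonoidHom.comp_apply,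
      RingHom.toAddMonoidHom_eq_coe, AddMonoidHom.coe_coe, map_mul]

end

end GrothendieckRing

/-! ### Almost finite `G`-spaces -/

/-- An almost finite `G`-space: a discrete topological space with a continuous action of `G`,
such that every open subgroup of `G` has only finitely many fixed points. -/
structure AlmostFiniteSpace (G : Type u) [Group G] [TopologicalSpace G] where
  carrier : Type u
  [top : TopologicalSpace carrier]
  [discrete : DiscreteTopology carrier]
  [action : MulAction G carrier]
  [continuous_action : ContinuousSMul G carrier]
  finite_fixed : ∀ U : OpenSubgroup G, {x : carrier | ∀ g ∈ U, g • x = x}.Finite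

namespace AlmostFiniteSpace

attribute [instance] AlmostFiniteSpace.top AlmostFiniteSpace.discrete AlmostFiniteSpace.action
  AlmostFiniteSpace.continuous_action

variable {G : Type u} [Group G] [TopologicalSpace G]

/-- Two almost finite `G`-spaces are isomorphic if there is a `G`-equivariant bijection between
them (it is a homeomorphism, the spaces being discrete). -/
def Iso (X Y : AlmostFiniteSpace G) : Prop :=
  ∃ f : X.carrier ≃ Y.carrier, ∀ (g : G) (x : X.carrier), f (g • x) = g • f x

instance isoSetoid (G : Type u) [Group G] [TopologicalSpace G] : Setoid (AlmostFiniteSpace G) where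
  r := Iso
  iseqv :=
    { refl := fun _ => ⟨Equiv.refl _, fun _ _ => rfl⟩
      symm := fun ⟨f, hf⟩ => ⟨f.symm, fun g x => by
        rw [Equiv.symm_apply_eq, hf, Equiv.apply_symm_apply]⟩
      trans := fun ⟨f, hf⟩ ⟨k, hk⟩ => ⟨f.trans k, fun g x => by simp [hf, hk]⟩ }

theorem continuousSMul_of_discrete {X : Type v} [TopologicalSpace X] [DiscreteTopology X]
    [MulAction G X] (h : ∀ x : X, Continuous fun g : G => g • x) : ContinuousSMul G X :=
  ⟨continuous_prod_of_discrete_right.mpr h⟩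

/-- The empty space. -/
def empty (G : Type u) [Group G] [TopologicalSpace G] : AlmostFiniteSpace G :=
  letI : TopologicalSpace PEmpty.{u + 1} := ⊥
  letI : MulAction G PEmpty.{u + 1} :=
    { smul := fun _ x => x, one_smul := fun _ => rfl, mul_smul := fun _ _ _ => rfl }
  haveI : DiscreteTopology PEmpty.{u + 1} := ⟨rfl⟩
  haveI : ContinuousSMul G PEmpty.{u + 1} := continuousSMul_of_discrete (fun x => x.elim)
  { carrier := PEmpty.{u + 1}
    finite_fixed := fun _ => Set.toFinite _ }

/-- The one-point space with the trivial action. -/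
def point (G : Type u) [Group G] [TopologicalSpace G] : AlmostFiniteSpace G :=
  letI : MulAction G PUnit.{u + 1} :=
    { smul := fun _ x => x, one_smul := fun _ => rfl, mul_smul := fun _ _ _ => rfl }
  haveI : ContinuousSMul G PUnit.{u + 1} :=
    continuousSMul_of_discrete (fun _ => continuous_const)
  { carrier := PUnit.{u + 1}
    finite_fixed := fun _ => Set.toFinite _ }

/-- The disjoint union. -/
def disjointUnion (X Y : AlmostFiniteSpace G) : AlmostFiniteSpace G :=
  letI : MulAction G (X.carrier ⊕ Y.carrier) :=
    { smul := fun g => Sum.map (g • ·) (g • ·)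
      one_smul := by rintro (x | x) <;> simp [HSMul.hSMul] <;> exact one_smul G x
      mul_smul := by rintro g h (x | x) <;> simp [HSMul.hSMul] <;> exact mul_smul g h x }
  haveI : ContinuousSMul G (X.carrier ⊕ Y.carrier) := continuousSMul_of_discrete (by
    rintro (x | x)
    · exact continuous_inl.comp (continuous_id.smul continuous_const)
    · exact continuous_inr.comp (continuous_id.smul continuous_const))
  { carrier := X.carrier ⊕ Y.carrier
    finite_fixed := fun U => by
      refine (((X.finite_fixed U).image Sum.inl).union ((Y.finite_fixed U).image Sum.inr)).subset ?_
      rintro (x | x) hx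
      · exact Or.inl ⟨x, fun g hg => Sum.inl_injective (hx g hg), rfl⟩
      · exact Or.inr ⟨x, fun g hg => Sum.inr_injective (hx g hg), rfl⟩ }

/-- The cartesian product with the diagonal action. -/
def product (X Y : AlmostFiniteSpace G) : AlmostFiniteSpace G where
  carrier := X.carrier × Y.carrier
  finite_fixed U := by
    refine ((X.finite_fixed U).prod (Y.finite_fixed U)).subset ?_
    rintro ⟨x, y⟩ h
    exact ⟨fun g hg => congrArg Prod.fst (h g hg), fun g hg => congrArg Prod.snd (h g hg)⟩

/-- The space `X^N` of fixed points of a normal subgroup `N`, with the induced action of `G ⧸ N`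
given by `gN • x = g • x`. -/
def fixed (N : Subgroup G) [N.Normal] (X : AlmostFiniteSpace G) : AlmostFiniteSpace (G ⧸ N) :=
  haveI : ContinuousSMul (G ⧸ N) (MulAction.fixedPoints N X.carrier) :=
    continuousSMul_of_discrete (fun x => by
      rw [(QuotientGroup.isQuotientMap_mk (N := N)).continuous_iff]
      exact (continuous_id.smul continuous_const).subtype_mk _)
  { carrier := MulAction.fixedPoints N X.carrier
    finite_fixed := fun V => by
      refine Set.Finite.of_finite_image (f := Subtype.val)
        ((X.finite_fixed (V.comap (QuotientGroup.mk' N) continuous_quotient_mk')).subset ?_)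
        Subtype.val_injective.injOn
      rintro _ ⟨x, hx, rfl⟩ g hg
      exact congrArg Subtype.val (hx (g : G ⧸ N) hg) }

/-- The set of isomorphism classes of almost finite `G`-spaces. -/
def Classes (G : Type u) [Group G] [TopologicalSpace G] : Type (u + 1) :=
  Quotient (isoSetoid G)

namespace Classes

instance : Zero (Classes G) := ⟨Quotient.mk _ (empty G)⟩

instance : One (Classes G) := ⟨Quotient.mk _ (point G)⟩

/-- Addition of isomorphism classes is the disjoint union. -/
instance : Add (Classes G) :=
  ⟨Quotient.map₂ disjointUnion (by
    rintro X X' ⟨f, hf⟩ Y Y' ⟨k, hk⟩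
    refine ⟨Equiv.sumCongr f k, ?_⟩
    rintro g (x | x)
    · exact congrArg Sum.inl (hf g x)
    · exact congrArg Sum.inr (hk g x))⟩

/-- Multiplication of isomorphism classes is the cartesian product. -/
instance : Mul (Classes G) :=
  ⟨Quotient.map₂ product (by
    rintro X X' ⟨f, hf⟩ Y Y' ⟨k, hk⟩
    exact ⟨Equiv.prodCongr f k, fun g x => Prod.ext (hf g x.1) (hk g x.2)⟩)⟩

instance : CommSemiring (Classes G) where
  nsmul := nsmulRec
  npow := npowRec
  natCast := Nat.unaryCast
  add_assoc := by
    rintro ⟨X⟩ ⟨Y⟩ ⟨Z⟩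
    refine Quotient.sound ⟨Equiv.sumAssoc _ _ _, ?_⟩
    rintro g ((x | x) | x) <;> rfl
  zero_add := by
    rintro ⟨X⟩
    refine Quotient.sound ⟨Equiv.emptySum PEmpty X.carrier, ?_⟩
    rintro g (x | x)
    · exact x.elim
    · rfl
  add_zero := by
    rintro ⟨X⟩
    refine Quotient.sound ⟨Equiv.sumEmpty X.carrier PEmpty, ?_⟩
    rintro g (x | x)
    · rfl
    · exact x.elim
  add_comm := by
    rintro ⟨X⟩ ⟨Y⟩
    refine Quotient.sound ⟨Equiv.sumComm _ _, ?_⟩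
    rintro g (x | x) <;> rfl
  left_distrib := by
    rintro ⟨X⟩ ⟨Y⟩ ⟨Z⟩
    refine Quotient.sound ⟨Equiv.prodSumDistrib _ _ _, ?_⟩
    rintro g ⟨x, (y | y)⟩ <;> rfl
  right_distrib := by
    rintro ⟨X⟩ ⟨Y⟩ ⟨Z⟩
    refine Quotient.sound ⟨Equiv.sumProdDistrib _ _ _, ?_⟩
    rintro g ⟨(x | x), y⟩ <;> rfl
  zero_mul := by
    rintro ⟨X⟩
    exact Quotient.sound ⟨Equiv.pemptyProd X.carrier, fun g x => x.1.elim⟩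
  mul_zero := by
    rintro ⟨X⟩
    exact Quotient.sound ⟨Equiv.prodPEmpty X.carrier, fun g x => x.2.elim⟩
  mul_assoc := by
    rintro ⟨X⟩ ⟨Y⟩ ⟨Z⟩
    exact Quotient.sound ⟨Equiv.prodAssoc _ _ _, fun g x => rfl⟩
  one_mul := by
    rintro ⟨X⟩
    exact Quotient.sound ⟨Equiv.punitProd X.carrier, fun g x => rfl⟩
  mul_one := by
    rintro ⟨X⟩
    exact Quotient.sound ⟨Equiv.prodPUnit X.carrier, fun g x => rfl⟩
  mul_comm := by
    rintro ⟨X⟩ ⟨Y⟩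
    exact Quotient.sound ⟨Equiv.prodComm _ _, fun g x => rfl⟩

/-- The homomorphism `[X] ↦ [X^N]` on isomorphism classes. -/
def fixHom (N : Subgroup G) [N.Normal] : Classes G →+* Classes (G ⧸ N) where
  toFun := Quotient.map (fixed N) (by
    rintro X Y ⟨f, hf⟩
    refine ⟨f.subtypeEquiv fun x => ?_, ?_⟩
    · refine forall_congr' fun n => ?_
      rw [Subgroup.smul_def, Subgroup.smul_def, ← hf, f.apply_eq_iff_eq]
    · rintro ⟨g⟩ x
      exact Subtype.ext (hf g x.1))
  map_zero' := Quotient.sound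
    ⟨⟨fun x => x.1, fun x => x.elim, fun x => x.1.elim, fun x => x.elim⟩, fun _ x => x.1.elim⟩
  map_one' := Quotient.sound
    ⟨⟨fun x => x.1, fun x => ⟨x, fun _ => rfl⟩, fun _ => rfl, fun _ => rfl⟩, fun _ _ => rfl⟩
  map_add' := by
    rintro ⟨X⟩ ⟨Y⟩
    refine Quotient.sound (Setoid.symm ⟨⟨?_, ?_, ?_, ?_⟩, ?_⟩)
    · exact Sum.elim (fun x => ⟨Sum.inl x.1, fun n => congrArg Sum.inl (x.2 n)⟩)
        (fun x => ⟨Sum.inr x.1, fun n => congrArg Sum.inr (x.2 n)⟩)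
    · rintro ⟨x | x, hx⟩
      · exact Sum.inl ⟨x, fun n => Sum.inl_injective (hx n)⟩
      · exact Sum.inr ⟨x, fun n => Sum.inr_injective (hx n)⟩
    · rintro (x | x) <;> rfl
    · rintro ⟨x | x, hx⟩ <;> rfl
    · rintro ⟨g⟩ (x | x) <;> rfl
  map_mul' := by
    rintro ⟨X⟩ ⟨Y⟩
    refine Quotient.sound ⟨⟨?_, ?_, ?_, ?_⟩, ?_⟩
    · exact fun x => (⟨x.1.1, fun n => congrArg Prod.fst (x.2 n)⟩,
        ⟨x.1.2, fun n => congrArg Prod.snd (x.2 n)⟩)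
    · exact fun x => ⟨(x.1.1, x.2.1), fun n => Prod.ext (x.1.2 n) (x.2.2 n)⟩
    · exact fun _ => rfl
    · exact fun _ => rfl
    · rintro ⟨g⟩ x
      rfl

end Classes

end AlmostFiniteSpace

/-! ### The Burnside ring -/

/-- The Burnside ring `B̂(G)`: the Grothendieck ring of the category of almost finite `G`-spaces.
For a finite discrete group, the almost finite spaces are the finite `G`-sets, and this is the
usual Burnside ring. -/
abbrev BurnsideRing (G : Type u) [Group G] [TopologicalSpace G] : Type (u + 1) :=
  GrothendieckRing (AlmostFiniteSpace.Classes G)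

namespace BurnsideRing

noncomputable section

variable (G : Type u) [Group G] [TopologicalSpace G]

variable {G} in
/-- The ring homomorphism `Fix_N : B̂(G) → B(G ⧸ N)`, `[X] ↦ [X^N]`. -/
def fix (N : OpenNormalSubgroup G) : BurnsideRing G →+* BurnsideRing (G ⧸ N.toSubgroup) :=
  GrothendieckRing.map (AlmostFiniteSpace.Classes.fixHom N.toSubgroup)

/-- The topology of the Burnside ring: the coarsest one for which all the maps `Fix_N` to the
discrete rings `B(G ⧸ N)` are continuous, `N` ranging over the open normal subgroups. As the
kernels of the `Fix_N` are directed downwards, they form a basis of neighbourhoods of `0`. -/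
instance topology : TopologicalSpace (BurnsideRing G) :=
  ⨅ N : OpenNormalSubgroup G, TopologicalSpace.induced (fix N) ⊥

/-- The spectrum of closed prime ideals of the Burnside ring, with the Zariski topology (the
subspace topology from the full prime spectrum: its closed sets are the sets of closed primes that
contain a given subset of the ring). -/
abbrev ClosedPrimeSpectrum : Type (u + 1) :=
  {p : PrimeSpectrum (BurnsideRing G) // IsClosed (p.asIdeal : Set (BurnsideRing G))}

end

end BurnsideRing

/-- A profinite group is prosoluble if all its quotients by open normal subgroups are soluble. -/
def IsProsoluble (G : Type u) [Group G] [TopologicalSpace G] : Prop :=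
  ∀ N : OpenNormalSubgroup G, Group.IsSolvable (G ⧸ N.toSubgroup)

/-! The marks `[X] ↦ |X^U|`, for `U` open, jointly embed the Burnside ring in a product of copies of
`ℤ` (`iso_of_card_fixedSet_eq`), so an idempotent amounts to a 0-1 function on open subgroups.

If `U` is normal of prime index `p` in `V`, the two marks agree modulo `p`, so an idempotent takes
the same value at both. When `G ⧸ N` is soluble, such steps join every subgroup containing `N` to
`N`. Every open subgroup contains some open normal `N`, so for prosoluble `G` all values of an
idempotent equal its value at `⊤`.

Conversely, in a finite group a mark at a soluble subgroup is never congruent, modulo any prime, to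
a mark at an insoluble one (`isSolvable_of_mark_modEq`). The two families of kernels are therefore
coprime, and if the group is insoluble this yields a nontrivial idempotent, which inflation carries
from `G ⧸ N` to `G`.

Connectedness of the full spectrum is the absence of nontrivial idempotents. For closed primes, each
one lies in a maximal ideal pulled back from some `B(G ⧸ N)`, whose spectrum is connected and also
supplies the kernel of the mark at `⊤`. -/

namespace GrothendieckRing

/-- The extension of a homomorphism from a semiring to a ring to the Grothendieck ring. -/
noncomputable def lift {S : Type u} {R : Type v} [CommSemiring S] [CommRing R] (f : S →+* R) :
    GrothendieckRing S →+* R where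
  __ := liftAdd f.toAddMonoidHom
  map_one' := by
    change liftAdd f.toAddMonoidHom (ofAdd 1) = 1
    simp
  map_mul' x y := by
    change liftAdd f.toAddMonoidHom (x * y)
      = liftAdd f.toAddMonoidHom x * liftAdd f.toAddMonoidHom y
    obtain ⟨a, b, rfl⟩ := exists_sub x
    obtain ⟨c, d, rfl⟩ := exists_sub y
    simp only [sub_mul, mul_sub, ← ofAdd_mul, map_sub, liftAdd_ofAdd,
      RingHom.toAddMonoidHom_eq_coe, AddMonoidHom.coe_coe, map_mul]

@[simp] theorem lift_ofAdd {S : Type u} {R : Type v} [CommSemiring S] [CommRing R] (f : S →+* R)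
    (s : S) : lift f (ofAdd s) = f s :=
  liftAdd_ofAdd f.toAddMonoidHom s

@[simp] theorem map_ofAdd {S : Type u} {T : Type v} [CommSemiring S] [CommSemiring T]
    (f : S →+* T) (s : S) : map f (ofAdd s) = ofAdd (f s) :=
  liftAdd_ofAdd (ofAdd.comp f.toAddMonoidHom) s

end GrothendieckRing

/-! ### Marks determine almost finite spaces -/

namespace AlmostFiniteSpace

variable {G : Type u} [Group G] [TopologicalSpace G]

/-- The points of an almost finite space fixed by an open subgroup. -/
def fixedSet (X : AlmostFiniteSpace G) (U : OpenSubgroup G) : Set X.carrier :=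
  {x | ∀ g ∈ U, g • x = x}

theorem finite_fixedSet (X : AlmostFiniteSpace G) (U : OpenSubgroup G) : (X.fixedSet U).Finite :=
  X.finite_fixed U

instance (X : AlmostFiniteSpace G) (U : OpenSubgroup G) : Finite (X.fixedSet U) :=
  X.finite_fixed U

/-- The stabilizer of a point of an almost finite space, as an open subgroup. -/
def openStabilizer (X : AlmostFiniteSpace G) (x : X.carrier) : OpenSubgroup G where
  __ := MulAction.stabilizer G x
  isOpen' := (isOpen_discrete {x}).preimage (f := fun g : G => g • x)
    (continuous_id.smul continuous_const)

@[simp] theorem mem_openStabilizer {X : AlmostFiniteSpace G} {x : X.carrier} {g : G} :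
    g ∈ X.openStabilizer x ↔ g • x = x := Iff.rfl

namespace Classes

/-- The number of points fixed by an open subgroup, as a homomorphism on isomorphism classes. -/
noncomputable def card (U : OpenSubgroup G) : Classes G →+* ℕ where
  toFun := Quotient.lift (fun X => Nat.card (X.fixedSet U)) (by
    rintro X Y ⟨f, hf⟩
    refine Nat.card_congr (f.subtypeEquiv fun x => forall₂_congr fun g _ => ?_)
    rw [← hf, f.apply_eq_iff_eq])
  map_zero' := by
    have : IsEmpty ((empty G).fixedSet U) := ⟨fun x => x.1.elim⟩
    exact Nat.card_of_isEmpty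
  map_one' := by
    have : Unique ((point G).fixedSet U) :=
      { default := ⟨PUnit.unit, fun _ _ => rfl⟩, uniq := fun _ => rfl }
    exact Nat.card_unique
  map_add' := by
    rintro ⟨X⟩ ⟨Y⟩
    refine Eq.trans (Nat.card_congr (Equiv.symm ⟨?_, ?_, ?_, ?_⟩))
      (Nat.card_sum (α := X.fixedSet U) (β := Y.fixedSet U))
    · exact Sum.elim (fun x => ⟨Sum.inl x.1, fun g hg => congrArg Sum.inl (x.2 g hg)⟩)
        (fun x => ⟨Sum.inr x.1, fun g hg => congrArg Sum.inr (x.2 g hg)⟩)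
    · rintro ⟨x | x, hx⟩
      · exact Sum.inl ⟨x, fun g hg => Sum.inl_injective (hx g hg)⟩
      · exact Sum.inr ⟨x, fun g hg => Sum.inr_injective (hx g hg)⟩
    · rintro (x | x) <;> rfl
    · rintro ⟨x | x, hx⟩ <;> rfl
  map_mul' := by
    rintro ⟨X⟩ ⟨Y⟩
    refine Eq.trans (Nat.card_congr ⟨?_, ?_, ?_, ?_⟩)
      (Nat.card_prod (X.fixedSet U) (Y.fixedSet U))
    · exact fun x => (⟨x.1.1, fun g hg => congrArg Prod.fst (x.2 g hg)⟩,
        ⟨x.1.2, fun g hg => congrArg Prod.snd (x.2 g hg)⟩)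
    · exact fun x => ⟨(x.1.1, x.2.1), fun g hg => Prod.ext (x.1.2 g hg) (x.2.2 g hg)⟩
    · exact fun _ => rfl
    · exact fun _ => rfl

end Classes

/-- An equivariant partial bijection between two spaces, given by its graph. -/
structure IsPartialIso (X Y : AlmostFiniteSpace G) (R : Set (X.carrier × Y.carrier)) : Prop where
  smul_mem : ∀ (g : G) (z : X.carrier × Y.carrier), z ∈ R → g • z ∈ R
  eq_iff : ∀ z ∈ R, ∀ w ∈ R, z.1 = w.1 ↔ z.2 = w.2

namespace IsPartialIso

variable {X Y : AlmostFiniteSpace G} {R : Set (X.carrier × Y.carrier)}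

theorem swap (h : IsPartialIso X Y R) : IsPartialIso Y X (Prod.swap ⁻¹' R) where
  smul_mem g z hz := h.smul_mem g z.swap hz
  eq_iff z hz w hw := (h.eq_iff z.swap hz w.swap hw).symm

/-- Invariance of `R` lets `eq_iff` compare a pair with its translate: matched points have equal
stabilizers. -/
theorem smul_eq_iff (h : IsPartialIso X Y R) {x : X.carrier} {y : Y.carrier} (hxy : (x, y) ∈ R)
    (g : G) : g • x = x ↔ g • y = y :=
  h.eq_iff (g • x, g • y) (h.smul_mem g _ hxy) (x, y) hxy

/-- A partial isomorphism matches the fixed points in its domain with those in its range. -/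
theorem ncard_fixedSet_inter (h : IsPartialIso X Y R) (U : OpenSubgroup G) :
    (X.fixedSet U ∩ Prod.fst '' R).ncard = (Y.fixedSet U ∩ Prod.snd '' R).ncard := by
  set T : Set (X.carrier × Y.carrier) := {z ∈ R | z.1 ∈ X.fixedSet U} with hT
  have h1 : X.fixedSet U ∩ Prod.fst '' R = Prod.fst '' T := by
    ext x
    constructor
    · rintro ⟨hx, z, hz, rfl⟩
      exact ⟨z, ⟨hz, hx⟩, rfl⟩
    · rintro ⟨z, ⟨hz, hx⟩, rfl⟩
      exact ⟨hx, z, hz, rfl⟩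
  have key : ∀ z ∈ R, z.1 ∈ X.fixedSet U ↔ z.2 ∈ Y.fixedSet U := fun z hz =>
    forall₂_congr fun g _ => h.smul_eq_iff hz g
  have h2 : Y.fixedSet U ∩ Prod.snd '' R = Prod.snd '' T := by
    ext x
    constructor
    · rintro ⟨hx, z, hz, rfl⟩
      exact ⟨z, ⟨hz, (key z hz).2 hx⟩, rfl⟩
    · rintro ⟨z, ⟨hz, hx⟩, rfl⟩
      exact ⟨(key z hz).1 hx, z, hz, rfl⟩
  rw [h1, h2, Set.InjOn.ncard_image, Set.InjOn.ncard_image]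
  · intro z hz w hw hzw
    exact Prod.ext ((h.eq_iff z hz.1 w hw.1).2 hzw) hzw
  · intro z hz w hw hzw
    exact Prod.ext hzw ((h.eq_iff z hz.1 w hw.1).1 hzw)

theorem ncard_fixedSet_diff (h : IsPartialIso X Y R)
    (hcard : ∀ U : OpenSubgroup G, Nat.card (X.fixedSet U) = Nat.card (Y.fixedSet U))
    (U : OpenSubgroup G) :
    (X.fixedSet U \ Prod.fst '' R).ncard = (Y.fixedSet U \ Prod.snd '' R).ncard := by
  have h1 := Set.ncard_inter_add_ncard_sdiff_eq_ncard (X.fixedSet U) (Prod.fst '' R)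
    (X.finite_fixedSet U)
  have h2 := Set.ncard_inter_add_ncard_sdiff_eq_ncard (Y.fixedSet U) (Prod.snd '' R)
    (Y.finite_fixedSet U)
  have h3 := hcard U
  have h4 := h.ncard_fixedSet_inter U
  rw [Nat.card_coe_set_eq, Nat.card_coe_set_eq] at h3
  omega

/-- Discarding matched points keeps the fixed-point counts equal, and `x` is itself an unmatched
fixed point of its stabilizer. -/
theorem exists_mem_fixedSet (h : IsPartialIso X Y R)
    (hcard : ∀ U : OpenSubgroup G, Nat.card (X.fixedSet U) = Nat.card (Y.fixedSet U))
    (x : X.carrier) (hx : x ∉ Prod.fst '' R) :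
    ∃ y, y ∉ Prod.snd '' R ∧ X.openStabilizer x ≤ Y.openStabilizer y := by
  have h1 : (X.fixedSet (X.openStabilizer x) \ Prod.fst '' R).ncard ≠ 0 :=
    Set.ncard_ne_zero_of_mem (a := x) ⟨fun g hg => hg, hx⟩ ((X.finite_fixedSet _).sdiff)
  rw [h.ncard_fixedSet_diff hcard] at h1
  obtain ⟨y, hy, hyR⟩ := Set.nonempty_of_ncard_ne_zero h1
  exact ⟨y, hyR, hy⟩

/-- Adjoining the orbit of a pair of points with the same stabilizer. -/
theorem union_orbit (h : IsPartialIso X Y R) {x : X.carrier} {y : Y.carrier}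
    (hx : x ∉ Prod.fst '' R) (hy : y ∉ Prod.snd '' R)
    (hxy : X.openStabilizer x = Y.openStabilizer y) :
    IsPartialIso X Y (R ∪ MulAction.orbit G (x, y)) := by
  have hst : ∀ g k : G, g • x = k • x ↔ g • y = k • y := fun g k => by
    have := SetLike.ext_iff.1 hxy (k⁻¹ * g)
    simpa [mul_smul, inv_smul_eq_iff] using this
  have hne : ∀ z ∈ R, ∀ g : G, z.1 ≠ g • x ∧ z.2 ≠ g • y := fun z hz g => by
    constructor
    · intro hzg
      exact hx ⟨g⁻¹ • z, h.smul_mem _ _ hz, by simp [hzg]⟩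
    · intro hzg
      exact hy ⟨g⁻¹ • z, h.smul_mem _ _ hz, by simp [hzg]⟩
  constructor
  · rintro g z (hz | ⟨k, rfl⟩)
    · exact Or.inl (h.smul_mem g z hz)
    · exact Or.inr ⟨g * k, mul_smul g k _⟩
  · rintro z (hz | ⟨k, rfl⟩) w (hw | ⟨l, rfl⟩)
    · exact h.eq_iff z hz w hw
    · exact iff_of_false (hne z hz l).1 (hne z hz l).2
    · exact iff_of_false (hne w hw k).1.symm (hne w hw k).2.symm
    · exact hst k l

end IsPartialIso

theorem exists_maximal_isPartialIso (X Y : AlmostFiniteSpace G) :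
    ∃ R, Maximal (IsPartialIso X Y) R := by
  refine zorn_subset {R | IsPartialIso X Y R} fun c hc hchain =>
    ⟨⋃₀ c, ⟨?_, ?_⟩, fun s hs => Set.subset_sUnion_of_mem hs⟩
  · rintro g z ⟨R, hR, hz⟩
    exact ⟨R, hR, (hc hR).smul_mem g z hz⟩
  · rintro z ⟨R, hR, hz⟩ w ⟨S, hS, hw⟩
    rcases hchain.total hR hS with hRS | hSR
    · exact (hc hS).eq_iff z (hRS hz) w hw
    · exact (hc hR).eq_iff z hz w (hSR hw)

theorem finiteIndex_of_compact [IsTopologicalGroup G] [CompactSpace G] (U : OpenSubgroup G) :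
    U.toSubgroup.FiniteIndex :=
  have := U.toSubgroup.quotient_finite_of_isOpen U.isOpen
  U.toSubgroup.finiteIndex_of_finite_quotient

/-- Burnside's theorem: an almost finite space is determined by the numbers of fixed points of the
open subgroups. -/
theorem iso_of_card_fixedSet_eq [IsTopologicalGroup G] [CompactSpace G] {X Y : AlmostFiniteSpace G}
    (hcard : ∀ U : OpenSubgroup G, Nat.card (X.fixedSet U) = Nat.card (Y.fixedSet U)) :
    Iso X Y := by
  obtain ⟨R, hR⟩ := exists_maximal_isPartialIso X Y
  have hiso : IsPartialIso X Y R := hR.prop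
  have hdom : ∀ x, x ∈ Prod.fst '' R := by
    by_contra! hne
    -- Take an unmatched `x` whose stabilizer has least index. Passing to `Y` and back gives
    -- stabilizers `x ≤ y ≤ x'`; minimality forces equality, and the orbit of `(x, y)` would enlarge
    -- the maximal `R`.
    obtain ⟨x, hx, hmin⟩ := WellFounded.has_min
      (measure fun x => (X.openStabilizer x).toSubgroup.index).wf {x | x ∉ Prod.fst '' R} hne
    obtain ⟨y, hy, hxy⟩ := hiso.exists_mem_fixedSet hcard x hx
    obtain ⟨x', hx', hyx'⟩ := hiso.swap.exists_mem_fixedSet (fun U => (hcard U).symm) y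
      (by simpa using hy)
    have hx'R : x' ∉ Prod.fst '' R := by simpa using hx'
    have := finiteIndex_of_compact (X.openStabilizer x)
    have heq : X.openStabilizer x = X.openStabilizer x' := by
      refine eq_of_le_of_not_lt (hxy.trans hyx') fun hlt => hmin x' hx'R ?_
      exact Subgroup.index_strictAnti hlt
    have hxy' : X.openStabilizer x = Y.openStabilizer y :=
      le_antisymm hxy (hyx'.trans heq.ge)
    exact hx ⟨(x, y), hR.le_of_ge (hiso.union_orbit hx hy hxy') Set.subset_union_left
      (Or.inr (MulAction.mem_orbit_self _)), rfl⟩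
  have hcod : ∀ y, y ∈ Prod.snd '' R := by
    by_contra! hne
    obtain ⟨y, hy⟩ := hne
    -- No minimality is needed here: an unmatched `y` would produce an unmatched `x`.
    obtain ⟨x, hx, -⟩ := hiso.swap.exists_mem_fixedSet (fun U => (hcard U).symm) y
      (by simpa using hy)
    exact hx (by simpa using hdom x)
  have hmem : ∀ x, ∃ y, (x, y) ∈ R := fun x => by
    obtain ⟨z, hz, rfl⟩ := hdom x
    exact ⟨z.2, hz⟩
  choose f hf using hmem
  refine ⟨Equiv.ofBijective f ⟨fun x x' hxx' => ?_, fun y => ?_⟩, fun g x => ?_⟩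
  · exact (hiso.eq_iff _ (hf x) _ (hf x')).2 hxx'
  · obtain ⟨z, hz, rfl⟩ := hcod y
    exact ⟨z.1, (hiso.eq_iff _ (hf z.1) _ hz).1 rfl⟩
  · exact (hiso.eq_iff _ (hf (g • x)) (g • (x, f x)) (hiso.smul_mem g _ (hf x))).1 rfl

end AlmostFiniteSpace

namespace BurnsideRing

open AlmostFiniteSpace

variable {G : Type u} [Group G] [TopologicalSpace G]

/-- The mark of an open subgroup `U`: the ring homomorphism `[X] ↦ |X^U|`. -/
noncomputable def mark (U : OpenSubgroup G) : BurnsideRing G →+* ℤ :=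
  GrothendieckRing.lift ((Nat.castRingHom ℤ).comp (Classes.card U))

/-- The class of an almost finite space in the Burnside ring. -/
noncomputable def of (X : AlmostFiniteSpace G) : BurnsideRing G :=
  GrothendieckRing.ofAdd (Quotient.mk _ X : Classes G)

theorem exists_of_sub_of (x : BurnsideRing G) :
    ∃ X Y : AlmostFiniteSpace G, x = of X - of Y := by
  obtain ⟨⟨X⟩, ⟨Y⟩, rfl⟩ := GrothendieckRing.exists_sub x
  exact ⟨X, Y, rfl⟩

@[simp] theorem mark_of (U : OpenSubgroup G) (X : AlmostFiniteSpace G) :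
    mark U (of X) = Nat.card (X.fixedSet U) :=
  GrothendieckRing.lift_ofAdd _ _

theorem eq_zero_of_mark_eq_zero [IsTopologicalGroup G] [CompactSpace G] {x : BurnsideRing G}
    (h : ∀ U, mark U x = 0) : x = 0 := by
  obtain ⟨X, Y, rfl⟩ := exists_of_sub_of x
  rw [sub_eq_zero]
  refine congrArg GrothendieckRing.ofAdd (Quotient.sound (iso_of_card_fixedSet_eq fun U => ?_))
  simpa [sub_eq_zero] using h U

theorem eq_of_mark_eq [IsTopologicalGroup G] [CompactSpace G] {x y : BurnsideRing G}
    (h : ∀ U, mark U x = mark U y) : x = y :=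
  sub_eq_zero.1 (eq_zero_of_mark_eq_zero fun U => by simp [h U])

theorem mark_eq_zero_or_one {e : BurnsideRing G} (he : IsIdempotentElem e) (U : OpenSubgroup G) :
    mark U e = 0 ∨ mark U e = 1 :=
  IsIdempotentElem.iff_eq_zero_or_one.1 (he.map (mark U))

end BurnsideRing

/-! ### Quotients by open normal subgroups, inflation and the topology -/

namespace OpenNormalSubgroup

variable {G : Type u} [Group G] [TopologicalSpace G]

/-- The preimage in `G` of an open subgroup of `G ⧸ N`. -/
def comapMk (N : OpenNormalSubgroup G) (V : OpenSubgroup (G ⧸ N.toSubgroup)) : OpenSubgroup G :=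
  V.comap (QuotientGroup.mk' N.toSubgroup) continuous_quotient_mk'

@[simp] theorem mem_comapMk {N : OpenNormalSubgroup G} {V : OpenSubgroup (G ⧸ N.toSubgroup)}
    {g : G} : g ∈ N.comapMk V ↔ (g : G ⧸ N.toSubgroup) ∈ V := Iff.rfl

theorem le_comapMk (N : OpenNormalSubgroup G) (V : OpenSubgroup (G ⧸ N.toSubgroup)) :
    N.toOpenSubgroup ≤ N.comapMk V := fun g hg => by
  rw [mem_comapMk, (QuotientGroup.eq_one_iff g).2 hg]
  exact one_mem V

variable [IsTopologicalGroup G]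

instance (N : OpenNormalSubgroup G) : DiscreteTopology (G ⧸ N.toSubgroup) :=
  QuotientGroup.discreteTopology N.isOpen'

/-- The image of a subgroup of `G` in the discrete group `G ⧸ N`. -/
def mapMk (N : OpenNormalSubgroup G) (U : OpenSubgroup G) : OpenSubgroup (G ⧸ N.toSubgroup) where
  __ := U.toSubgroup.map (QuotientGroup.mk' N.toSubgroup)
  isOpen' := isOpen_discrete _

theorem comapMk_mapMk (N : OpenNormalSubgroup G) {U : OpenSubgroup G} (h : N.toOpenSubgroup ≤ U) :
    N.comapMk (N.mapMk U) = U := by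
  apply OpenSubgroup.toSubgroup_injective
  refine (QuotientGroup.comap_map_mk' N.toSubgroup U.toSubgroup).trans (sup_eq_right.2 h)

theorem exists_le_openSubgroup [CompactSpace G] (U : OpenSubgroup G) :
    ∃ N : OpenNormalSubgroup G, N.toOpenSubgroup ≤ U :=
  IsTopologicalGroup.exist_openNormalSubgroup_sub_clopen_nhds_of_one U.isClopen (one_mem U)

end OpenNormalSubgroup

namespace AlmostFiniteSpace

variable {G : Type u} [Group G] [TopologicalSpace G]

theorem natCard_fixedSet_fixed (N : OpenNormalSubgroup G) (X : AlmostFiniteSpace G)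
    (V : OpenSubgroup (G ⧸ N.toSubgroup)) :
    Nat.card ((fixed N.toSubgroup X).fixedSet V) = Nat.card (X.fixedSet (N.comapMk V)) :=
  Nat.card_congr
    { toFun := fun x => ⟨x.1.1, fun g hg => congrArg Subtype.val (x.2 (g : G ⧸ N.toSubgroup) hg)⟩
      invFun := fun x => ⟨⟨x.1, fun n => x.2 n.1 (N.le_comapMk V n.2)⟩, by
        rintro ⟨g⟩ hg
        exact Subtype.ext (x.2 g hg)⟩
      left_inv := fun _ => rfl
      right_inv := fun _ => rfl }

variable [IsTopologicalGroup G]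

/-- A `G ⧸ N`-space as a `G`-space. -/
def inflate (N : OpenNormalSubgroup G) (X : AlmostFiniteSpace (G ⧸ N.toSubgroup)) :
    AlmostFiniteSpace G :=
  letI : MulAction G X.carrier := MulAction.compHom X.carrier (QuotientGroup.mk' N.toSubgroup)
  haveI : ContinuousSMul G X.carrier := continuousSMul_of_discrete fun x =>
    (continuous_id.smul continuous_const : Continuous fun q : G ⧸ N.toSubgroup => q • x).comp
      continuous_quotient_mk'
  { carrier := X.carrier
    finite_fixed := fun U => (X.finite_fixed (N.mapMk U)).subset (by
      rintro x hx _ ⟨g, hg, rfl⟩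
      exact hx g hg) }

theorem natCard_fixedSet_inflate (N : OpenNormalSubgroup G)
    (X : AlmostFiniteSpace (G ⧸ N.toSubgroup)) (V : OpenSubgroup (G ⧸ N.toSubgroup)) :
    Nat.card ((inflate N X).fixedSet (N.comapMk V)) = Nat.card (X.fixedSet V) :=
  Nat.card_congr
    { toFun := fun x => ⟨x.1, by
        rintro ⟨g⟩ hg
        exact x.2 g hg⟩
      invFun := fun x => ⟨x.1, fun g hg => x.2 (g : G ⧸ N.toSubgroup) hg⟩
      left_inv := fun _ => rfl
      right_inv := fun _ => rfl }

/-- Inflation as a homomorphism on isomorphism classes. -/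
def Classes.inflateHom (N : OpenNormalSubgroup G) : Classes (G ⧸ N.toSubgroup) →+* Classes G where
  toFun := Quotient.map (inflate N) (by
    rintro X Y ⟨f, hf⟩
    exact ⟨f, fun g x => hf g x⟩)
  map_zero' := Quotient.sound ⟨Equiv.refl _, fun _ x => x.elim⟩
  map_one' := Quotient.sound ⟨Equiv.refl _, fun _ _ => rfl⟩
  map_add' := by
    rintro ⟨X⟩ ⟨Y⟩
    refine Quotient.sound ⟨Equiv.refl _, ?_⟩
    rintro g (x | x) <;> rfl
  map_mul' := by
    rintro ⟨X⟩ ⟨Y⟩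
    exact Quotient.sound ⟨Equiv.refl _, fun _ _ => rfl⟩

end AlmostFiniteSpace

namespace BurnsideRing

open AlmostFiniteSpace

variable {G : Type u} [Group G] [TopologicalSpace G]

theorem mark_fix (N : OpenNormalSubgroup G) (V : OpenSubgroup (G ⧸ N.toSubgroup))
    (x : BurnsideRing G) : mark V (fix N x) = mark (N.comapMk V) x := by
  obtain ⟨X, Y, rfl⟩ := exists_of_sub_of x
  have h : ∀ X : AlmostFiniteSpace G, mark V (fix N (of X)) = mark (N.comapMk V) (of X) := by
    intro X
    have : fix N (of X) = of (fixed N.toSubgroup X) := GrothendieckRing.map_ofAdd _ _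
    rw [this, mark_of, mark_of, natCard_fixedSet_fixed]
  simp only [map_sub, h]

theorem isClopen_preimage_fix (N : OpenNormalSubgroup G)
    (S : Set (BurnsideRing (G ⧸ N.toSubgroup))) : IsClopen (fix N ⁻¹' S) := by
  have h : @Continuous _ _ (topology G) ⊥ (fix N) :=
    continuous_iInf_dom (i := N) continuous_induced_dom
  -- The target must carry the discrete topology here, in place of the instance `topology`.
  let _ : TopologicalSpace (BurnsideRing (G ⧸ N.toSubgroup)) := ⊥
  have : DiscreteTopology (BurnsideRing (G ⧸ N.toSubgroup)) := ⟨rfl⟩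
  exact (isClopen_discrete S).preimage h

variable [IsTopologicalGroup G]

/-- The inflation homomorphism from the Burnside ring of a quotient. -/
noncomputable def inflation (N : OpenNormalSubgroup G) :
    BurnsideRing (G ⧸ N.toSubgroup) →+* BurnsideRing G :=
  GrothendieckRing.map (Classes.inflateHom N)

theorem mark_inflation (N : OpenNormalSubgroup G) (V : OpenSubgroup (G ⧸ N.toSubgroup))
    (x : BurnsideRing (G ⧸ N.toSubgroup)) : mark (N.comapMk V) (inflation N x) = mark V x := by
  obtain ⟨X, Y, rfl⟩ := exists_of_sub_of x
  have h : ∀ X : AlmostFiniteSpace (G ⧸ N.toSubgroup),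
      mark (N.comapMk V) (inflation N (of X)) = mark V (of X) := by
    intro X
    have : inflation N (of X) = of (inflate N X) := GrothendieckRing.map_ofAdd _ _
    rw [this, mark_of, mark_of, natCard_fixedSet_inflate]
  simp only [map_sub, h]

variable [CompactSpace G]

/-- Both sides have the same marks. Hence `Fix_N` is a split surjection and inflation is injective.
-/
theorem fix_inflation (N : OpenNormalSubgroup G) (x : BurnsideRing (G ⧸ N.toSubgroup)) :
    fix N (inflation N x) = x :=
  eq_of_mark_eq fun V => by rw [mark_fix, mark_inflation]

theorem fix_surjective (N : OpenNormalSubgroup G) : Function.Surjective (fix N) :=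
  fun x => ⟨_, fix_inflation N x⟩

/-- The marks of `G ⧸ N` detect zero, and they pull back to the marks of `G` at the open subgroups
containing `N`. -/
theorem mem_ker_fix {N : OpenNormalSubgroup G} {x : BurnsideRing G} :
    x ∈ RingHom.ker (fix N) ↔ ∀ U : OpenSubgroup G, N.toOpenSubgroup ≤ U → mark U x = 0 := by
  refine ⟨fun h U hU => ?_, fun h => eq_zero_of_mark_eq_zero fun V => ?_⟩
  · rw [← N.comapMk_mapMk hU, ← mark_fix, (RingHom.mem_ker).1 h, map_zero]
  · rw [mark_fix, h _ (N.le_comapMk V)]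

theorem ker_fix_mono {N M : OpenNormalSubgroup G} (h : N.toOpenSubgroup ≤ M.toOpenSubgroup) :
    RingHom.ker (fix N) ≤ RingHom.ker (fix M) := fun _ hx =>
  mem_ker_fix.2 fun U hU => mem_ker_fix.1 hx U (h.trans hU)

theorem ker_fix_le_ker_mark {N : OpenNormalSubgroup G} {U : OpenSubgroup G}
    (h : N.toOpenSubgroup ≤ U) : RingHom.ker (fix N) ≤ RingHom.ker (mark U) :=
  fun _ hx => mem_ker_fix.1 hx U h

/-- An ideal containing the kernel of some `Fix_N` is closed. -/
theorem isClosed_of_ker_fix_le {N : OpenNormalSubgroup G} {I : Ideal (BurnsideRing G)}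
    (h : RingHom.ker (fix N) ≤ I) : IsClosed (I : Set (BurnsideRing G)) := by
  -- Since `I` contains the kernel of a surjection, it is the full preimage of its image, hence
  -- clopen.
  have : (I : Set (BurnsideRing G)) = fix N ⁻¹' (I.map (fix N) : Set _) := by
    have := Ideal.comap_map_of_surjective' (fix N) (fix_surjective N) I
    rw [sup_eq_left.2 h] at this
    exact congrArg (fun J : Ideal (BurnsideRing G) => (J : Set (BurnsideRing G))) this.symm
  rw [this]
  exact (isClopen_preimage_fix N _).isClosed

instance nonempty_openNormalSubgroup : Nonempty (OpenNormalSubgroup G) :=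
  ⟨(OpenNormalSubgroup.exists_le_openSubgroup (⊤ : OpenSubgroup G)).choose⟩

/-- A proper closed ideal stays proper after adding the kernel of some `Fix_N`. -/
theorem exists_sup_ker_fix_ne_top {I : Ideal (BurnsideRing G)} (hI : I ≠ ⊤)
    (hclosed : IsClosed (I : Set (BurnsideRing G))) :
    ∃ N : OpenNormalSubgroup G, I ⊔ RingHom.ker (fix N) ≠ ⊤ := by
  have hmem : (I : Set (BurnsideRing G))ᶜ ∈ nhds (1 : BurnsideRing G) :=
    hclosed.isOpen_compl.mem_nhds fun h => hI ((Ideal.eq_top_iff_one I).2 h)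
  have hn : nhds (1 : BurnsideRing G) =
      ⨅ N : OpenNormalSubgroup G, Filter.principal (fix N ⁻¹' {1}) := by
    rw [nhds_iInf]
    refine iInf_congr fun N => ?_
    rw [@nhds_induced _ _ ⊥, @nhds_discrete _ ⊥ (@DiscreteTopology.mk _ ⊥ rfl), map_one]
    exact Filter.comap_pure.trans rfl
  -- Directedness turns the infimum into a single `N` for which the coset `1 + ker Fix_N` misses
  -- `I`; writing `1 = a + b` in the sum of ideals would put `a` in both.
  rw [hn, Filter.mem_iInf_of_directed] at hmem
  · obtain ⟨N, hN⟩ := hmem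
    refine ⟨N, fun htop => ?_⟩
    obtain ⟨a, ha, b, hb, hab⟩ := Submodule.mem_sup.1 ((Ideal.eq_top_iff_one _).1 htop)
    have hb' : fix N b = 0 := hb
    have h1 := congrArg (fix N) hab
    rw [map_add, hb', add_zero, map_one] at h1
    have h2 : a ∈ fix N ⁻¹' {1} := h1
    exact Filter.mem_principal.1 hN h2 ha
  · have hle : ∀ {N M : OpenNormalSubgroup G}, N.toOpenSubgroup ≤ M.toOpenSubgroup →
        (fix N ⁻¹' {1} : Set (BurnsideRing G)) ⊆ fix M ⁻¹' {1} := by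
      intro N M h x hx
      have hx' : x - 1 ∈ RingHom.ker (fix N) := by
        rw [RingHom.mem_ker, map_sub, Set.mem_singleton_iff.1 hx, map_one, sub_self]
      have := RingHom.mem_ker.1 (ker_fix_mono h hx')
      rwa [map_sub, map_one, sub_eq_zero] at this
    intro N M
    refine ⟨N ⊓ M, Filter.principal_mono.2 (hle ?_), Filter.principal_mono.2 (hle ?_)⟩
    · exact fun g hg => hg.1
    · exact fun g hg => hg.2

end BurnsideRing

/-! ### Congruences between marks and the prosoluble case -/

namespace AlmostFiniteSpace

variable {G : Type u} [Group G] [TopologicalSpace G]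

/-- The group `V ⧸ U` of order `p` acts on `X^U` with fixed points `X^V`, and its other orbits have
size `p`. -/
theorem natCard_fixedSet_modEq (X : AlmostFiniteSpace G) {U V : OpenSubgroup G} (hUV : U ≤ V)
    (hn : (U.toSubgroup.subgroupOf V.toSubgroup).Normal) {p : ℕ} [Fact p.Prime]
    (hp : U.toSubgroup.relIndex V.toSubgroup = p) :
    Nat.card (X.fixedSet U) ≡ Nat.card (X.fixedSet V) [MOD p] := by
  let N := U.toSubgroup.subgroupOf V.toSubgroup
  let e : MulAction.fixedPoints N X.carrier ≃ X.fixedSet U :=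
    { toFun := fun x => ⟨x.1, fun g hg => x.2 ⟨⟨g, hUV hg⟩, hg⟩⟩
      invFun := fun x => ⟨x.1, fun n => x.2 n.1.1 n.2⟩
      left_inv := fun _ => rfl
      right_inv := fun _ => rfl }
  let e' : MulAction.fixedPoints (V.toSubgroup ⧸ N) (MulAction.fixedPoints N X.carrier) ≃
      X.fixedSet V :=
    { toFun := fun x => ⟨x.1.1, fun g hg => congrArg Subtype.val
        (x.2 (QuotientGroup.mk (⟨g, hg⟩ : V.toSubgroup)))⟩
      invFun := fun x => ⟨⟨x.1, fun n => x.2 n.1.1 n.1.2⟩, by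
        rintro ⟨g⟩
        exact Subtype.ext (x.2 g.1 g.2)⟩
      left_inv := fun _ => rfl
      right_inv := fun _ => rfl }
  have : Finite (MulAction.fixedPoints N X.carrier) := Finite.of_equiv _ e.symm
  have hG : IsPGroup p (V.toSubgroup ⧸ N) := IsPGroup.of_card (n := 1) (by rw [pow_one]; exact hp)
  rw [← Nat.card_congr e, ← Nat.card_congr e']
  exact hG.card_modEq_card_fixedPoints _

end AlmostFiniteSpace

/-- A maximal subgroup above the proper commutator subgroup is normal, with abelian simple quotient.
-/
theorem Group.IsSolvable.exists_normal_index_prime {K : Type*} [Group K] [Finite K] [Nontrivial K]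
    [Group.IsSolvable K] : ∃ L : Subgroup K, L.Normal ∧ L.index.Prime := by
  obtain ⟨M, hM, hle⟩ := (eq_top_or_exists_le_coatom (commutator K)).resolve_left
    (Group.IsSolvable.commutator_lt_top_of_nontrivial K).ne
  have hn : M.Normal := Subgroup.Normal.of_commutator_le _ hle
  refine ⟨M, hn, ?_⟩
  have hcomm : IsMulCommutative (K ⧸ M) :=
    Subgroup.Normal.quotient_commutative_iff_commutator_le.2 hle
  have : Nontrivial (K ⧸ M) := QuotientGroup.nontrivial_iff.2 hM.1
  have hs : IsSimpleGroup (K ⧸ M) := by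
    refine ⟨fun H _ => ?_⟩
    have h1 : M ≤ H.comap (QuotientGroup.mk' M) := by
      intro g hg
      rw [Subgroup.mem_comap, QuotientGroup.mk'_apply, (QuotientGroup.eq_one_iff g).2 hg]
      exact one_mem H
    have hinj := Subgroup.comap_injective (QuotientGroup.mk'_surjective M)
    rcases h1.eq_or_lt with h | h
    · left
      apply hinj
      rw [← h, MonoidHom.comap_bot, QuotientGroup.ker_mk']
    · right
      apply hinj
      rw [hM.2 _ h, Subgroup.comap_top]
  exact (Group.is_simple_iff_prime_card.1 hs)

theorem Subgroup.exists_normal_relIndex_prime {Q : Type*} [Group Q] [Finite Q]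
    {K : Subgroup Q} [Group.IsSolvable K] (hK : K ≠ ⊥) :
    ∃ L < K, (L.subgroupOf K).Normal ∧ (L.relIndex K).Prime := by
  have := (Subgroup.nontrivial_iff_ne_bot K).2 hK
  obtain ⟨L, hn, hp⟩ := Group.IsSolvable.exists_normal_index_prime (K := K)
  have hL : (L.map K.subtype).subgroupOf K = L :=
    Subgroup.comap_map_eq_self_of_injective K.subtype_injective L
  refine ⟨L.map K.subtype, lt_of_le_of_ne (Subgroup.map_subtype_le L) fun h => ?_, ?_, ?_⟩
  · rw [← hL, h, Subgroup.subgroupOf_self, Subgroup.index_top] at hp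
    exact Nat.not_prime_one hp
  · rwa [hL]
  · rwa [Subgroup.relIndex, hL]

namespace BurnsideRing

open AlmostFiniteSpace

variable {G : Type u} [Group G] [TopologicalSpace G]

theorem mark_modEq {U V : OpenSubgroup G} (hUV : U ≤ V)
    (hn : (U.toSubgroup.subgroupOf V.toSubgroup).Normal) {p : ℕ} (hp : p.Prime)
    (hidx : U.toSubgroup.relIndex V.toSubgroup = p) (x : BurnsideRing G) :
    mark U x ≡ mark V x [ZMOD p] := by
  have := Fact.mk hp
  obtain ⟨X, Y, rfl⟩ := exists_of_sub_of x
  simp only [map_sub, mark_of]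
  exact (Int.natCast_modEq_iff.2 (X.natCard_fixedSet_modEq hUV hn hidx)).sub
    (Int.natCast_modEq_iff.2 (Y.natCard_fixedSet_modEq hUV hn hidx))

/-- Both values are 0 or 1, and these are distinct modulo a prime. -/
theorem mark_eq_of_isIdempotentElem {U V : OpenSubgroup G} (hUV : U ≤ V)
    (hn : (U.toSubgroup.subgroupOf V.toSubgroup).Normal)
    (hp : (U.toSubgroup.relIndex V.toSubgroup).Prime) {e : BurnsideRing G}
    (he : IsIdempotentElem e) : mark U e = mark V e := by
  have h := (mark_modEq hUV hn hp rfl e).dvd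
  have h2 : ¬ ((U.toSubgroup.relIndex V.toSubgroup : ℕ) : ℤ) ∣ 1 := fun hd =>
    hp.one_lt.ne' (by exact_mod_cast Int.eq_one_of_dvd_one (by positivity) hd)
  rcases mark_eq_zero_or_one he U with hU | hU <;> rcases mark_eq_zero_or_one he V with hV | hV <;>
    rw [hU, hV] at h ⊢
  · exact absurd h (by simpa using h2)
  · exact absurd h (by simpa using h2)

variable [IsTopologicalGroup G] [CompactSpace G]

theorem finite_quotient (N : OpenNormalSubgroup G) : Finite (G ⧸ N.toSubgroup) :=
  N.toSubgroup.quotient_finite_of_isOpen N.isOpen'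

/-- Descend from `V` to the trivial subgroup of `G ⧸ N` through normal subgroups of prime index;
normality and index survive taking preimages in `G`. -/
theorem mark_eq_mark_of_isSolvable (N : OpenNormalSubgroup G)
    [Group.IsSolvable (G ⧸ N.toSubgroup)] {e : BurnsideRing G} (he : IsIdempotentElem e)
    (V : OpenSubgroup (G ⧸ N.toSubgroup)) :
    mark (N.comapMk V) e = mark N.toOpenSubgroup e := by
  have := finite_quotient N
  obtain ⟨K, hK⟩ := V
  induction K using WellFoundedLT.induction with
  | ind K ih =>
    by_cases hbot : K = ⊥
    · congr 2
      ext g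
      rw [OpenNormalSubgroup.mem_comapMk]
      subst hbot
      exact QuotientGroup.eq_one_iff g
    · obtain ⟨L, hlt, hn, hp⟩ := Subgroup.exists_normal_relIndex_prime hbot
      rw [← ih L hlt (isOpen_discrete _)]
      have hc : ∀ H : Subgroup (G ⧸ N.toSubgroup), ∀ hH, (N.comapMk ⟨H, hH⟩).toSubgroup =
        H.comap (QuotientGroup.mk' N.toSubgroup) := fun _ _ => rfl
      refine (mark_eq_of_isIdempotentElem (fun g hg => hlt.le hg) ?_ ?_ he).symm
      · rw [hc, hc]
        rw [Subgroup.normal_subgroupOf_iff hlt.le] at hn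
        rw [Subgroup.normal_subgroupOf_iff (Subgroup.comap_mono hlt.le)]
        exact fun h k hh hk => hn h k hh hk
      · rwa [hc, hc, Subgroup.relIndex_comap, Subgroup.map_comap_eq_self_of_surjective
          (QuotientGroup.mk'_surjective _)]

theorem eq_zero_or_one_of_isProsoluble (hG : IsProsoluble G) {e : BurnsideRing G}
    (he : IsIdempotentElem e) : e = 0 ∨ e = 1 := by
  have h : ∀ U : OpenSubgroup G, mark U e = mark ⊤ e := fun U => by
    obtain ⟨N, hN⟩ := OpenNormalSubgroup.exists_le_openSubgroup U
    have := hG N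
    rw [← N.comapMk_mapMk hN, mark_eq_mark_of_isSolvable N he,
      ← N.comapMk_mapMk (U := ⊤) le_top, mark_eq_mark_of_isSolvable N he]
  rcases mark_eq_zero_or_one he ⊤ with h0 | h1
  · exact Or.inl (eq_zero_of_mark_eq_zero fun U => (h U).trans h0)
  · exact Or.inr (eq_of_mark_eq fun U => by rw [h U, h1, map_one])

end BurnsideRing

/-! ### Idempotents from insoluble finite quotients -/

namespace Subgroup

variable {H : Type*} [Group H]

/-- If `p` divides the number of fixed points of `U` on its cosets, then `U` is normal of index `p`
in some larger subgroup. -/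
theorem exists_normal_relIndex_eq_of_dvd [Finite H] (U : Subgroup H) {p : ℕ} (hp : p.Prime)
    (hdvd : p ∣ Nat.card (MulAction.fixedPoints U (H ⧸ U))) :
    ∃ W, U ≤ W ∧ (U.subgroupOf W).Normal ∧ U.relIndex W = p := by
  have := Fact.mk hp
  set n : Subgroup H := normalizer (U : Set H)
  rw [Nat.card_congr (Sylow.fixedPointsMulLeftCosetsEquivQuotient U)] at hdvd
  -- The fixed cosets form `N(U) ⧸ U`. Cauchy gives an element of order `p` there, and the preimage
  -- of the cyclic group it generates is `W`.
  obtain ⟨x, hx⟩ := exists_prime_orderOf_dvd_card' (G := n ⧸ U.subgroupOf n) p hdvd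
  let π := QuotientGroup.mk' (U.subgroupOf n)
  have hU : U = ((⊥ : Subgroup (n ⧸ U.subgroupOf n)).comap π).map n.subtype := by
    rw [MonoidHom.comap_bot, QuotientGroup.ker_mk', map_subgroupOf_eq_of_le le_normalizer]
  have hle : U ≤ ((zpowers x).comap π).map n.subtype := by
    conv_lhs => rw [hU]
    exact map_mono (comap_mono bot_le)
  refine ⟨((zpowers x).comap π).map n.subtype, hle,
    normal_subgroupOf_of_le_normalizer (map_subtype_le _), ?_⟩
  conv_lhs => enter [1]; rw [hU]
  rw [relIndex_map_map_of_injective _ _ n.subtype_injective, relIndex_comap,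
    map_comap_eq_self_of_surjective (QuotientGroup.mk'_surjective _), relIndex_bot_left,
    Nat.card_zpowers, hx]

theorem isSolvable_of_normal_of_relIndex_prime {U W : Subgroup H} (hUW : U ≤ W)
    (hn : (U.subgroupOf W).Normal) (hp : (U.relIndex W).Prime) [Group.IsSolvable U] :
    Group.IsSolvable W := by
  have := Fact.mk hp
  have : IsCyclic (W ⧸ U.subgroupOf W) := isCyclic_of_prime_card (p := U.relIndex W) rfl
  refine (Group.isSolvable_iff_subgroup_quotient (U.subgroupOf W)).2 ⟨?_, ?_⟩
  · exact Group.isSolvable_of_isSolvable_injective (subgroupOfEquivOfLe hUW).injective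
      (f := (subgroupOfEquivOfLe hUW).toMonoidHom)
  · exact Group.isSolvable_of_comm IsCyclic.isMulCommutative.is_comm.comm

/-- If `V` fixes `gU`, conjugation by `g⁻¹` embeds `V` in `U`. -/
theorem isSolvable_of_fixed_coset {U V : Subgroup H} [Group.IsSolvable U] (y : H ⧸ U)
    (hy : ∀ v ∈ V, v • y = y) : Group.IsSolvable V := by
  obtain ⟨g, rfl⟩ := QuotientGroup.mk_surjective y
  have h : ∀ v : V, g⁻¹ * v * g ∈ U := fun v => by
    rw [mul_assoc]
    exact QuotientGroup.eq.1 (hy v.1 v.2).symm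
  let f : V →* U := (((MulAut.conj g⁻¹).toMonoidHom).comp V.subtype).codRestrict U
    fun v => by simpa using h v
  refine Group.isSolvable_of_isSolvable_injective (f := f) ?_
  rw [MonoidHom.injective_codRestrict]
  exact (MulAut.conj g⁻¹).injective.comp V.subtype_injective

end Subgroup

namespace AlmostFiniteSpace

variable {G : Type u} [Group G] [TopologicalSpace G] [IsTopologicalGroup G] [CompactSpace G]

/-- The coset space of an open subgroup. -/
def coset (U : OpenSubgroup G) : AlmostFiniteSpace G where
  carrier := G ⧸ U.toSubgroup
  finite_fixed _ := by
    have := U.toSubgroup.quotient_finite_of_isOpen U.isOpen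
    exact Set.toFinite _

end AlmostFiniteSpace

namespace BurnsideRing

open AlmostFiniteSpace

section Coprime

variable {H : Type u} [Group H] [TopologicalSpace H]

theorem mark_surjective (U : OpenSubgroup H) : Function.Surjective (mark U) := fun n =>
  ⟨n, map_intCast _ n⟩

/-- The kernels of two marks are coprime if the marks are not congruent modulo any prime. -/
theorem isCoprime_ker_mark {U V : OpenSubgroup H}
    (h : ∀ p : ℕ, p.Prime → ¬ ∀ x : BurnsideRing H, mark U x ≡ mark V x [ZMOD p]) :
    IsCoprime (RingHom.ker (mark U)) (RingHom.ker (mark V)) := by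
  obtain ⟨n, hn⟩ := (IsPrincipalIdealRing.principal ((RingHom.ker (mark V)).map (mark U))).principal
  have hunit : n.natAbs = 1 := by
    by_contra hne
    -- This covers `n = 0` too. As `x - mark V x` is in the kernel of `mark V`, its image under
    -- `mark U` is a multiple of `n`, so `p` would give a forbidden congruence.
    obtain ⟨p, hp, hpn⟩ := Nat.exists_prime_and_dvd hne
    refine h p hp fun x => (Int.modEq_iff_dvd.2 ?_).symm
    have hx : x - (mark V x : ℤ) ∈ RingHom.ker (mark V) := by
      simp [RingHom.mem_ker]
    have := Ideal.mem_map_of_mem (mark U) hx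
    rw [hn] at this
    have h2 := (Int.natCast_dvd.2 hpn).trans (Ideal.mem_span_singleton.1 this)
    simpa using h2
  have htop : (1 : ℤ) ∈ (RingHom.ker (mark V)).map (mark U) := by
    rw [hn]
    exact Ideal.mem_span_singleton.2 (Int.isUnit_iff_natAbs_eq.2 hunit).dvd
  obtain ⟨b, hb, hb1⟩ := (Ideal.mem_map_iff_of_surjective _ (mark_surjective U)).1 htop
  refine Ideal.isCoprime_iff_exists.2 ⟨1 - b, ?_, b, hb, sub_add_cancel _ _⟩
  rw [RingHom.mem_ker, map_sub, map_one, hb1, sub_self]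

end Coprime

section Finite

variable {H : Type u} [Group H] [TopologicalSpace H] [IsTopologicalGroup H] [Finite H]

instance : Finite (OpenSubgroup H) :=
  Finite.of_injective _ OpenSubgroup.toSubgroup_injective

/-- Enlarge `U` to a maximal soluble `W` with mark congruent to that of `V`. Then `p` does not
divide `|(H ⧸ W)^W|`, so `V` also fixes a point of `H ⧸ W` and is conjugate into `W`. -/
theorem isSolvable_of_mark_modEq [DiscreteTopology H] {U V : OpenSubgroup H}
    (hU : Group.IsSolvable U.toSubgroup) {p : ℕ} (hp : p.Prime)
    (h : ∀ x : BurnsideRing H, mark U x ≡ mark V x [ZMOD p]) : Group.IsSolvable V.toSubgroup := by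
  obtain ⟨W, hWmax⟩ := (Set.toFinite {W : OpenSubgroup H | Group.IsSolvable W.toSubgroup ∧
    ∀ x : BurnsideRing H, mark W x ≡ mark V x [ZMOD p]}).exists_maximal ⟨U, hU, h⟩
  obtain ⟨hW, hWV⟩ := hWmax.prop
  have hcard : Nat.card ((coset W).fixedSet W) =
      Nat.card (MulAction.fixedPoints W.toSubgroup (H ⧸ W.toSubgroup)) :=
    Nat.card_congr
      { toFun := fun x => ⟨x.1, fun g => x.2 g.1 g.2⟩
        invFun := fun x => ⟨x.1, fun g hg => x.2 ⟨g, hg⟩⟩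
        left_inv := fun _ => rfl
        right_inv := fun _ => rfl }
  have hndvd : ¬ p ∣ Nat.card ((coset W).fixedSet W) := by
    intro hdvd
    rw [hcard] at hdvd
    -- This `K` is again soluble with a congruent mark, against the maximality of `W`.
    obtain ⟨K, hle, hn, hidx⟩ := W.toSubgroup.exists_normal_relIndex_eq_of_dvd hp hdvd
    let K' : OpenSubgroup H := ⟨K, isOpen_discrete _⟩
    have hmem : Group.IsSolvable K'.toSubgroup ∧
        ∀ x : BurnsideRing H, mark K' x ≡ mark V x [ZMOD p] :=
      ⟨Subgroup.isSolvable_of_normal_of_relIndex_prime hle hn (hidx ▸ hp), fun x =>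
        (mark_modEq (V := K') hle hn hp hidx x).symm.trans (hWV x)⟩
    have hKW : K ≤ W.toSubgroup := hWmax.le_of_ge hmem hle
    rw [Subgroup.relIndex_eq_one.2 hKW] at hidx
    exact hp.one_lt.ne hidx
  have hV : Nat.card ((coset W).fixedSet V) ≠ 0 := by
    intro h0
    have := hWV (of (coset W))
    rw [mark_of, mark_of, h0] at this
    exact hndvd (Int.natCast_dvd_natCast.1 (Int.modEq_zero_iff_dvd.1 this))
  have : Nonempty ((coset W).fixedSet V) := (Nat.card_ne_zero.1 hV).1
  obtain ⟨y, hy⟩ := this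
  exact Subgroup.isSolvable_of_fixed_coset (U := W.toSubgroup) y hy

/-- Dress: the Burnside ring of a finite group that is not soluble has a nontrivial idempotent. -/
theorem exists_isIdempotentElem [DiscreteTopology H] (hH : ¬ Group.IsSolvable H) :
    ∃ e : BurnsideRing H, IsIdempotentElem e ∧ e ≠ 0 ∧ e ≠ 1 := by
  classical
  have := Fintype.ofFinite (OpenSubgroup H)
  let S : Finset (OpenSubgroup H) := {U | Group.IsSolvable U.toSubgroup}
  have hS : ∀ U, U ∈ S ↔ Group.IsSolvable U.toSubgroup := fun U => by simp [S]
  have hco : IsCoprime (⨅ V ∈ Sᶜ, RingHom.ker (mark V)) (⨅ U ∈ S, RingHom.ker (mark U)) := by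
    refine Ideal.isCoprime_biInf fun U hU => (Ideal.isCoprime_biInf fun V hV => ?_).symm
    refine isCoprime_ker_mark fun p hp hmod => ?_
    exact Finset.mem_compl.1 hV ((hS V).2 (isSolvable_of_mark_modEq ((hS U).1 hU) hp hmod))
  -- The mark of `a` is 1 at soluble subgroups and 0 at the others. The trivial subgroup shows `a ≠
  -- 0`, and the whole group shows `a ≠ 1`.
  obtain ⟨a, ha, b, hb, hab⟩ := Ideal.isCoprime_iff_exists.1 hco
  simp only [Ideal.mem_iInf, RingHom.mem_ker] at ha hb
  have hmul : a * b = 0 := eq_zero_of_mark_eq_zero fun U => by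
    by_cases hU : U ∈ S
    · rw [map_mul, hb U hU, mul_zero]
    · rw [map_mul, ha U (Finset.mem_compl.2 hU), zero_mul]
  refine ⟨a, ?_, ?_, ?_⟩
  · rw [IsIdempotentElem]
    conv_rhs => rw [← mul_one a, ← hab, mul_add, hmul, add_zero]
  · rintro rfl
    let B : OpenSubgroup H := ⟨⊥, isOpen_discrete _⟩
    have hB : B ∈ S := (hS B).2 (inferInstanceAs (Group.IsSolvable (⊥ : Subgroup H)))
    have := hb B hB
    rw [← zero_add b, hab, map_one] at this
    exact one_ne_zero this
  · rintro rfl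
    have htop : (⊤ : OpenSubgroup H) ∉ S := fun h => hH <| by
      have := (hS _).1 h
      exact Group.isSolvable_of_surjective (f := (⊤ : Subgroup H).subtype)
        fun g => ⟨⟨g, trivial⟩, rfl⟩
    have := ha ⊤ (Finset.mem_compl.2 htop)
    rw [map_one] at this
    exact one_ne_zero this

end Finite

variable {G : Type u} [Group G] [TopologicalSpace G] [IsTopologicalGroup G] [CompactSpace G]

theorem exists_isIdempotentElem_of_not_isProsoluble (hG : ¬ IsProsoluble G) :
    ∃ e : BurnsideRing G, IsIdempotentElem e ∧ e ≠ 0 ∧ e ≠ 1 := by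
  obtain ⟨N, hN⟩ := not_forall.1 hG
  have := finite_quotient N
  obtain ⟨e, he, h0, h1⟩ := exists_isIdempotentElem hN
  refine ⟨inflation N e, he.map _, fun h => h0 ?_, fun h => h1 ?_⟩
  · rw [← fix_inflation N e, h, map_zero]
  · rw [← fix_inflation N e, h, map_one]

theorem isProsoluble_iff_isIdempotentElem :
    IsProsoluble G ↔ ∀ e : BurnsideRing G, IsIdempotentElem e → e = 0 ∨ e = 1 := by
  refine ⟨fun hG e he => eq_zero_or_one_of_isProsoluble hG he, fun h => ?_⟩
  by_contra hG
  obtain ⟨e, he, h0, h1⟩ := exists_isIdempotentElem_of_not_isProsoluble hG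
  exact (h e he).elim h0 h1

end BurnsideRing

/-! ### Connectedness of the spectra -/

theorem PrimeSpectrum.connectedSpace_iff_isIdempotentElem (R : Type*) [CommRing R] [Nontrivial R] :
    ConnectedSpace (PrimeSpectrum R) ↔ ∀ e : R, IsIdempotentElem e → e = 0 ∨ e = 1 := by
  constructor
  · intro h e he
    have hc : IsClopen (basicOpen e : Set (PrimeSpectrum R)) :=
      isClopen_iff_mul_add.2 ⟨e, 1 - e, he.mul_one_sub_self, by ring, rfl⟩
    rcases _root_.isClopen_iff.1 hc with h0 | h1
    · exact Or.inl (basicOpen_injOn_isIdempotentElem he IsIdempotentElem.zero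
        (SetLike.coe_injective (by simpa using h0)))
    · exact Or.inr (basicOpen_injOn_isIdempotentElem he IsIdempotentElem.one
        (SetLike.coe_injective (by simpa using h1)))
  · refine fun h => connectedSpace_iff_clopen.2 ⟨inferInstance, fun s hs => ?_⟩
    obtain ⟨e, he, rfl⟩ := exists_idempotent_basicOpen_eq_of_isClopen hs
    rcases h e he with rfl | rfl <;> simp

namespace BurnsideRing

open AlmostFiniteSpace

variable {G : Type u} [Group G] [TopologicalSpace G]

instance : Nontrivial (BurnsideRing G) := (mark (⊤ : OpenSubgroup G)).domain_nontrivial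

theorem isProsoluble_quotient (hG : IsProsoluble G) (N : OpenNormalSubgroup G) :
    IsProsoluble (G ⧸ N.toSubgroup) := fun _ =>
  have := hG N
  inferInstance

variable [IsTopologicalGroup G] [CompactSpace G]

theorem isProsoluble_iff_connectedSpace_primeSpectrum :
    IsProsoluble G ↔ ConnectedSpace (PrimeSpectrum (BurnsideRing G)) :=
  isProsoluble_iff_isIdempotentElem.trans
    (PrimeSpectrum.connectedSpace_iff_isIdempotentElem _).symm

theorem isClosed_ker_mark (U : OpenSubgroup G) :
    IsClosed (RingHom.ker (mark U) : Set (BurnsideRing G)) :=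
  have ⟨_, hN⟩ := OpenNormalSubgroup.exists_le_openSubgroup U
  isClosed_of_ker_fix_le (ker_fix_le_ker_mark hN)

/-- The kernel of a mark as a closed prime ideal. -/
noncomputable def kerMark (U : OpenSubgroup G) : ClosedPrimeSpectrum G :=
  ⟨⟨RingHom.ker (mark U), RingHom.ker_isPrime _⟩, isClosed_ker_mark U⟩

/-- The map from the spectrum of `B(G ⧸ N)` to the closed prime ideals induced by `Fix_N`. -/
noncomputable def comapFix (N : OpenNormalSubgroup G)
    (q : PrimeSpectrum (BurnsideRing (G ⧸ N.toSubgroup))) : ClosedPrimeSpectrum G :=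
  ⟨PrimeSpectrum.comap (fix N) q, isClosed_of_ker_fix_le (N := N) (Ideal.ker_le_comap _)⟩

theorem continuous_comapFix (N : OpenNormalSubgroup G) : Continuous (comapFix N) :=
  (PrimeSpectrum.continuous_comap (fix N)).subtype_mk _

theorem mem_range_comapFix {N : OpenNormalSubgroup G} {q : ClosedPrimeSpectrum G}
    (h : RingHom.ker (fix N) ≤ q.1.asIdeal) : q ∈ Set.range (comapFix N) := by
  have : q.1 ∈ Set.range (PrimeSpectrum.comap (fix N)) := by
    rw [range_comap_of_surjective _ _ (fix_surjective N)]
    exact h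
  obtain ⟨p, hp⟩ := this
  exact ⟨p, Subtype.ext hp⟩

/-- Every closed prime `q` specializes to a closed maximal ideal `m'` containing some `ker Fix_N`.
Both `m'` and `kerMark ⊤` lie in the image of the connected space `Spec B(G ⧸ N)`, so `m'` lies in
`s`, and openness of `s` brings in `q`. -/
theorem eq_univ_of_isClopen (hG : IsProsoluble G) {s : Set (ClosedPrimeSpectrum G)}
    (hs : IsClopen s) (htop : kerMark ⊤ ∈ s) : s = Set.univ := by
  refine Set.eq_univ_of_forall fun q => ?_
  obtain ⟨N, hN⟩ := exists_sup_ker_fix_ne_top q.1.isPrime.ne_top q.2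
  obtain ⟨m, hm, hle⟩ := Ideal.exists_le_maximal _ hN
  have hker : RingHom.ker (fix N) ≤ m := le_sup_right.trans hle
  let m' : ClosedPrimeSpectrum G := ⟨⟨m, hm.isPrime⟩, isClosed_of_ker_fix_le hker⟩
  have hspec : q ⤳ m' := (subtype_specializes_iff _ _).2
    ((PrimeSpectrum.le_iff_specializes _ _).1 (le_sup_left.trans hle))
  refine hspec.mem_open hs.isOpen ?_
  have := isProsoluble_iff_connectedSpace_primeSpectrum.1 (isProsoluble_quotient hG N)
  obtain ⟨p, hp⟩ := mem_range_comapFix (q := m') hker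
  obtain ⟨t, ht⟩ := mem_range_comapFix (q := kerMark ⊤) (ker_fix_le_ker_mark (N := N) le_top)
  have huniv : comapFix N ⁻¹' s = Set.univ :=
    (hs.preimage (continuous_comapFix N)).eq_univ ⟨t, by rwa [Set.mem_preimage, ht]⟩
  rw [← hp]
  exact Set.eq_univ_iff_forall.1 huniv p

theorem isProsoluble_iff_connectedSpace_closedPrimeSpectrum :
    IsProsoluble G ↔ ConnectedSpace (ClosedPrimeSpectrum G) := by
  constructor
  · intro hG
    refine connectedSpace_iff_clopen.2 ⟨⟨kerMark ⊤⟩, fun s hs => ?_⟩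
    by_cases htop : kerMark ⊤ ∈ s
    · exact Or.inr (eq_univ_of_isClopen hG hs htop)
    · exact Or.inl (Set.compl_univ_iff.1 (eq_univ_of_isClopen hG hs.compl htop))
  · intro h
    refine isProsoluble_iff_isIdempotentElem.2 fun e he => ?_
    have hc : IsClopen (PrimeSpectrum.basicOpen e : Set (PrimeSpectrum (BurnsideRing G))) :=
      PrimeSpectrum.isClopen_iff_mul_add.2 ⟨e, 1 - e, he.mul_one_sub_self, by ring, rfl⟩
    have hc' := hc.preimage (continuous_subtype_val (p := fun p : PrimeSpectrum (BurnsideRing G) =>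
      IsClosed (p.asIdeal : Set (BurnsideRing G))))
    -- The points `kerMark U` already suffice to read off every mark of `e` from the clopen set it
    -- cuts out.
    have hmem : ∀ U : OpenSubgroup G, kerMark U ∈ Subtype.val ⁻¹'
        (PrimeSpectrum.basicOpen e : Set (PrimeSpectrum (BurnsideRing G))) ↔ mark U e ≠ 0 :=
      fun U => Iff.rfl
    rcases isClopen_iff.1 hc' with h0 | h1
    · refine Or.inl (eq_zero_of_mark_eq_zero fun U => ?_)
      by_contra hne
      exact Set.eq_empty_iff_forall_notMem.1 h0 _ ((hmem U).2 hne)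
    · refine Or.inr (eq_of_mark_eq fun U => ?_)
      rw [map_one]
      exact (mark_eq_zero_or_one he U).resolve_left
        ((hmem U).1 (Set.eq_univ_iff_forall.1 h1 _))

end BurnsideRing

/-- For a profinite group `G`, being prosoluble is equivalent to each of the following:
the Burnside ring has no idempotents except `0` and `1`; the space of its closed prime ideals is
connected; the space of all its prime ideals is connected. -/
theorem proposition6p1 (G : Type u) [Group G] [TopologicalSpace G] [IsTopologicalGroup G]
    [CompactSpace G] [TotallyDisconnectedSpace G] :
    (IsProsoluble G ↔ ∀ e : BurnsideRing G, IsIdempotentElem e → e = 0 ∨ e = 1) ∧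
    (IsProsoluble G ↔ ConnectedSpace (BurnsideRing.ClosedPrimeSpectrum G)) ∧
    (IsProsoluble G ↔ ConnectedSpace (PrimeSpectrum (BurnsideRing G))) :=
  ⟨BurnsideRing.isProsoluble_iff_isIdempotentElem,
    BurnsideRing.isProsoluble_iff_connectedSpace_closedPrimeSpectrum,
    BurnsideRing.isProsoluble_iff_connectedSpace_primeSpectrum⟩
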